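/- Let $d\ge 1$, $\sigma>0$, $\xi\in(-1,1)$, $a_s>0$, $a_t>0$, and let $\tilde x\in\mathbb{R}^d$ be a unit vector. For $\gamma(u)=a_t^2u^2$ or $\gamma(u)=a_t|u|$, consider the squared-exponential Gneiting covariance $$C_0(h,u)=\frac{\sigma}{(\gamma(u)+1)^{d/2}}\exp\left(-\frac{a_s^2\|h\|^2}{\gamma(u)+1}\right),\qquad h\in\mathbb{R}^d,\ u\in\mathbb{R}.$$ It has a spectral density of the form $\sigma f^*(\|x\|,|\eta|)$, that is, a nonnegative integrable function on $\mathbb{R}^d\times\mathbb{R}$ with $C_0(h,u)=\int_{\mathbb{R}}\int_{\mathbb{R}^d}e^{i(\langle h,x\rangle+u\eta)}\,\sigma f^*(\|x\|,|\eta|)\,dx\,d\eta$ for all $h,u$. For any such $f^*$, let $$C(h,u)=\int_{\mathbb{R}}\int_{\mathbb{R}^d}e^{i(\langle h,x\rangle+u\eta)}\,\sigma f^*(\|x\|,|\eta|)\left\{1+\xi\,\mathrm{sign}(\langle x,\tilde x\rangle)\,\mathrm{sign}(\eta)\right\}dx\,d\eta$$ be the corresponding asymmetric covariance. Then $C$ has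 the following half-spectral representations, for all $h\in\mathbb{R}^d$ and $u\in\mathbb{R}$, where the integrands are integrable over $\mathbb{R}^d$. (i) If $\gamma(u)=a_t^2u^2$, then $$C(h,u)=\sigma\int_{\mathbb{R}^d}\frac{e^{i\langle h,x\rangle}}{(2a_s\sqrt{\pi})^d}\exp\left\{-\frac{\|x\|^2}{4a_s^2}(a_t^2u^2+1)\right\}\left\{1+i\,\xi\,\mathrm{sign}(\langle x,\tilde x\rangle)\,\mathrm{erfi}\left(\frac{\|x\|}{2a_s}a_tu\right)\right\}dx.$$ (ii) If $\gamma(u)=a_t|u|$, then $$C(h,u)=\sigma\int_{\mathbb{R}^d}\frac{e^{i\langle h,x\rangle}}{(2a_s\sqrt{\pi})^d}\exp\left\{-\frac{\|x\|^2}{4a_s^2}(a_t|u|+1)\right\}\left\{1+i\,\xi\,\mathrm{sign}(\langle x,\tilde x\rangle)\,Z(x,u)\right\}dx,$$ $$Z(x,u)=\frac{\mathrm{sign}(u)}{\pi}\left\{\mathrm{Ei}(w)+e^{2w}E_1(w)\right\},\qquad w=\frac{\|x\|^2}{4a_s^2}a_t|u|,$$ with $Z(x,0)=0$. Here $\mathrm{erfi}(z)=\frac{2}{\sqrt{\pi}}\int_0^z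 e^{t^2}dt$ and, for $z>0$, $E_1(z)=\int_z^\infty\frac{e^{-t}}{t}dt$ and $\mathrm{Ei}(z)=\mathrm{p.v.}\int_{-\infty}^z\frac{e^t}{t}dt$. -/

import Mathlib

open MeasureTheory Filter Topology

noncomputable section

/-- The imaginary error function on the real line, `erfi z = (2 / √π) ∫₀ᶻ exp (t²) dt`. -/
def realErfi (z : ℝ) : ℝ :=
  2 / Real.sqrt Real.pi * ∫ t in (0 : ℝ)..z, Real.exp (t ^ 2)

/-- The exponential integral `E₁ z = ∫_z^∞ exp (-t) / t dt`, for `z > 0`. -/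
def expIntegralE1 (z : ℝ) : ℝ :=
  ∫ t in Set.Ioi z, Real.exp (-t) / t

/-- The integral of `exp t / t` over `(-∞, z]` with the interval `(-ε, ε)` removed (`0 < ε ≤ z`). -/
def expIntegralEiCut (z ε : ℝ) : ℝ :=
  (∫ t in Set.Iic (-ε), Real.exp t / t) + ∫ t in ε..z, Real.exp t / t

/-- The exponential integral `Ei z`, for `z > 0`: the Cauchy principal value at `0` of
`∫_{-∞}^z exp t / t dt`. -/
def expIntegralEi (z : ℝ) : ℝ :=
  limUnder (𝓝[>] (0 : ℝ)) (expIntegralEiCut z)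

/-- The principal value defining `Ei z` exists for `z > 0`. -/
theorem tendsto_expIntegralEiCut {z : ℝ} (hz : 0 < z) :
    Tendsto (expIntegralEiCut z) (𝓝[>] (0 : ℝ)) (𝓝 (expIntegralEi z)) := by
  apply tendsto_nhds_limUnder
  have hint : ∀ ε : ℝ, 0 < ε → IntegrableOn (fun t : ℝ => Real.exp (-t) / t) (Set.Ioi ε) := by
    intro ε hε
    have h1 : IntegrableOn (fun t : ℝ => ε⁻¹ * Real.exp (-t)) (Set.Ioi ε) :=
      (integrableOn_exp_neg_Ioi ε).const_mul _
    refine Integrable.mono' h1 ?_ ?_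
    · exact (by fun_prop : Measurable fun t : ℝ => Real.exp (-t) / t).aestronglyMeasurable
    · refine (ae_restrict_iff' measurableSet_Ioi).2 (Eventually.of_forall fun t ht => ?_)
      have ht' : ε < t := ht
      have h0 : 0 < t := hε.trans ht'
      rw [Real.norm_of_nonneg (by positivity), div_eq_inv_mul]
      gcongr
  have hcont : Continuous (fun t : ℝ => dslope (fun s => Real.exp s - Real.exp (-s)) 0 t) := by
    rw [continuous_iff_continuousAt]
    intro t
    by_cases ht : t = 0
    · subst ht
      exact continuousAt_dslope_same.2 (by fun_prop)
    · exact (continuousAt_dslope_of_ne ht).2 (by fun_prop)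
  set g : ℝ → ℝ := fun t => dslope (fun s => Real.exp s - Real.exp (-s)) 0 t with hg
  have key : ∀ ε ∈ Set.Ioo (0 : ℝ) z, expIntegralEiCut z ε =
      (∫ t in ε..z, g t) - expIntegralE1 z := by
    intro ε hε
    have hI : ∀ t ∈ Set.uIcc ε z, t ≠ 0 := by
      intro t ht
      rw [Set.uIcc_of_le hε.2.le] at ht
      exact (hε.1.trans_le ht.1).ne'
    have i1 : IntervalIntegrable (fun t : ℝ => Real.exp t / t) volume ε z :=
      (ContinuousOn.div (by fun_prop) (by fun_prop) hI).intervalIntegrable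
    have i2 : IntervalIntegrable (fun t : ℝ => Real.exp (-t) / t) volume ε z :=
      (ContinuousOn.div (by fun_prop) (by fun_prop) hI).intervalIntegrable
    have e1 : (∫ t in Set.Iic (-ε), Real.exp t / t) = -∫ t in Set.Ioi ε, Real.exp (-t) / t := by
      rw [← integral_comp_neg_Ioi, ← integral_neg]
      congr 1
      ext t
      rw [div_neg]
    have e2 : (∫ t in Set.Ioi ε, Real.exp (-t) / t) =
        (∫ t in ε..z, Real.exp (-t) / t) + expIntegralE1 z :=
      (intervalIntegral.integral_interval_add_Ioi (hint ε hε.1) (hint z hz)).symm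
    have e3 : (∫ t in ε..z, g t) =
        (∫ t in ε..z, Real.exp t / t) - ∫ t in ε..z, Real.exp (-t) / t := by
      rw [← intervalIntegral.integral_sub i1 i2]
      refine intervalIntegral.integral_congr fun t ht => ?_
      simp only [hg, dslope_of_ne _ (hI t ht), slope_def_field]
      simp [sub_div]
    rw [expIntegralEiCut, e1, e2, e3]
    ring
  refine ⟨(∫ t in (0 : ℝ)..z, g t) - expIntegralE1 z, ?_⟩
  have hc : Continuous fun ε : ℝ => ∫ t in ε..z, g t := by
    have : (fun ε : ℝ => ∫ t in ε..z, g t) = fun ε => -∫ t in z..ε, g t := by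
      ext ε
      exact intervalIntegral.integral_symm _ _
    rw [this]
    exact (intervalIntegral.continuous_primitive
      (fun a b => hcont.intervalIntegrable a b) z).neg
  refine Tendsto.congr' ?_ ((hc.sub continuous_const).continuousAt.tendsto.mono_left
    nhdsWithin_le_nhds)
  filter_upwards [Ioo_mem_nhdsGT hz] with ε hε
  exact (key ε hε).symm

/-- A spectral density of a real stationary space-time covariance `C` on `ℝᵈ × ℝ`:
a nonnegative integrable function with `f (-x) (-η) = f x η` and
`C h u = ∫ ∫ exp (i (⟨h, x⟩ + u η)) f x η dx dη`. -/
structure IsSpaceTimeSpectralDensity {d : ℕ}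
    (C : EuclideanSpace ℝ (Fin d) → ℝ → ℝ) (f : EuclideanSpace ℝ (Fin d) → ℝ → ℝ) : Prop where
  nonneg : ∀ x η, 0 ≤ f x η
  symm : ∀ x η, f (-x) (-η) = f x η
  integrable : Integrable (fun p : EuclideanSpace ℝ (Fin d) × ℝ => f p.1 p.2)
  bochner : ∀ h u, (C h u : ℂ) =
    ∫ η : ℝ, ∫ x : EuclideanSpace ℝ (Fin d),
      Complex.exp (Complex.I * ((inner ℝ h x : ℝ) + u * η : ℝ)) * (f x η : ℂ)

/-- The Gneiting class of space-time covariances with temporal variogram `γ`, function `φ`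
and exponents `τ`, `b`. -/
def gneitingCovariance {d : ℕ} (σ τ b : ℝ) (γ φ : ℝ → ℝ)
    (h : EuclideanSpace ℝ (Fin d)) (u : ℝ) : ℝ :=
  σ / (γ u + 1) ^ τ * φ (‖h‖ ^ 2 / (γ u + 1) ^ b)

/-- The squared-exponential Gneiting covariance on `ℝᵈ × ℝ`,
`σ (γ u + 1) ^ (-d / 2) exp (-aₛ² ‖h‖² / (γ u + 1))`: the member of the Gneiting class with
`φ r = exp (-aₛ² r)`, `τ = d / 2` and `b = 1`. -/
def sqExpGneitingCovariance {d : ℕ} (σ aₛ : ℝ) (γ : ℝ → ℝ)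
    (h : EuclideanSpace ℝ (Fin d)) (u : ℝ) : ℝ :=
  gneitingCovariance σ ((d : ℝ) / 2) 1 γ (fun r => Real.exp (-(aₛ ^ 2 * r))) h u

/-- The reflective asymmetric spectral density
`σ f*(‖x‖, |η|) (1 + ξ sign ⟨x, x̃⟩ sign η)`. -/
def asymSpectralDensity {d : ℕ} (σ ξ : ℝ) (xt : EuclideanSpace ℝ (Fin d)) (fstar : ℝ → ℝ → ℝ)
    (x : EuclideanSpace ℝ (Fin d)) (η : ℝ) : ℝ :=
  σ * fstar ‖x‖ |η| * (1 + ξ * Real.sign (inner ℝ x xt) * Real.sign η)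

/-- The asymmetric space-time covariance whose spectral density is `asymSpectralDensity`. -/
def asymCovariance {d : ℕ} (σ ξ : ℝ) (xt : EuclideanSpace ℝ (Fin d)) (fstar : ℝ → ℝ → ℝ)
    (h : EuclideanSpace ℝ (Fin d)) (u : ℝ) : ℂ :=
  ∫ η : ℝ, ∫ x : EuclideanSpace ℝ (Fin d),
    Complex.exp (Complex.I * ((inner ℝ h x : ℝ) + u * η : ℝ)) *
      (asymSpectralDensity σ ξ xt fstar x η : ℂ)

/-- The half-spectral density for `γ u = aₜ² u²`. -/
def halfSpectralQuadratic {d : ℕ} (ξ aₛ aₜ : ℝ) (xt : EuclideanSpace ℝ (Fin d))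
    (x : EuclideanSpace ℝ (Fin d)) (u : ℝ) : ℂ :=
  ((1 / (2 * aₛ * Real.sqrt Real.pi) ^ d *
      Real.exp (-(‖x‖ ^ 2 / (4 * aₛ ^ 2) * (aₜ ^ 2 * u ^ 2 + 1))) : ℝ) : ℂ) *
    (1 + Complex.I *
      ((ξ * Real.sign (inner ℝ x xt) * realErfi (‖x‖ / (2 * aₛ) * aₜ * u) : ℝ) : ℂ))

/-- The factor `Z` of the asymmetric part for `γ u = aₜ |u|`; with `w = ‖x‖² aₜ |u| / (4 aₛ²)`,
it is `sign u / π * (Ei w + exp (2 w) E₁ w)`. -/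
def asymFactorZ {d : ℕ} (aₛ aₜ : ℝ) (x : EuclideanSpace ℝ (Fin d)) (u : ℝ) : ℝ :=
  Real.sign u / Real.pi *
    (expIntegralEi (‖x‖ ^ 2 / (4 * aₛ ^ 2) * aₜ * |u|) +
      Real.exp (2 * (‖x‖ ^ 2 / (4 * aₛ ^ 2) * aₜ * |u|)) *
        expIntegralE1 (‖x‖ ^ 2 / (4 * aₛ ^ 2) * aₜ * |u|))

/-- The half-spectral density for `γ u = aₜ |u|`. -/
def halfSpectralLinear {d : ℕ} (ξ aₛ aₜ : ℝ) (xt : EuclideanSpace ℝ (Fin d))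
    (x : EuclideanSpace ℝ (Fin d)) (u : ℝ) : ℂ :=
  ((1 / (2 * aₛ * Real.sqrt Real.pi) ^ d *
      Real.exp (-(‖x‖ ^ 2 / (4 * aₛ ^ 2) * (aₜ * |u| + 1))) : ℝ) : ℂ) *
    (1 + Complex.I *
      ((ξ * Real.sign (inner ℝ x xt) * asymFactorZ aₛ aₜ x u : ℝ) : ℂ))

end

/-! Up to the factor `σ`, the symmetric covariance is the spatial Fourier integral of `A exp(-β‖x‖²)
φ(κ(‖x‖) u)`, where either `φ v = exp(-v²)` with `κ` linear, or `φ v = exp(-|v|)` with `κ` quadratic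
(`sqExpGneitingCovariance_eq_integral`). Since `φ` is the Fourier transform of an even density `k`,
Gaussian or Cauchy, dilating `k` by `κ(‖x‖)` gives an explicit spectral density, `mixtureDensity`.
Any other admissible `f*` agrees with it almost everywhere by injectivity of the Fourier transform
(`ae_eq_of_fourier_eq`), so the asymmetric covariance can be computed from the mixture. Integrating
over `η` first, `ξ sign⟨x, x̃⟩` is a constant and `sign η` replaces `φ` by `i ψ`, with `ψ` the sine
transform of `k` (`asymCovariance_mixture`).

It remains to find `ψ`. For the Gaussian, the sine integral solves a linear ODE, which gives
Dawson's function (`integral_sin_mul_gaussian`). For the Cauchy density, `1/(1+y²)` is written as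
the integral of `exp(-s) cos(ys)`, the `y`-integral is damped by `exp(-εy)`, and the order is
exchanged. As `ε → 0` the kernels `t/(ε²+t²)` tend to the principal value of `1/t`, which produces
`Ei` and `E₁` (`integral_sin_mul_inv_one_add_sq`). -/

/-- A nonnegative even integrable function `k` on the line, together with its Fourier transform `φ`
and its sine transform `ψ`. -/
structure IsEvenSpectralKernel (k φ ψ : ℝ → ℝ) : Prop where
  nonneg : ∀ y, 0 ≤ k y
  abs : ∀ y, k |y| = k y
  continuous : Continuous k
  integrable : Integrable k
  fourier : ∀ v : ℝ, ∫ y : ℝ, Complex.exp (Complex.I * ((v * y : ℝ) : ℂ)) * (k y : ℂ) = (φ v : ℂ)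
  signFourier : ∀ v : ℝ, ∫ y : ℝ, Complex.exp (Complex.I * ((v * y : ℝ) : ℂ)) *
    ((Real.sign y * k y : ℝ) : ℂ) = Complex.I * (ψ v : ℂ)

/-! ### Signs, and dilations of an even kernel -/

theorem measurable_realSign : Measurable Real.sign := by
  unfold Real.sign
  exact Measurable.ite measurableSet_Iio measurable_const
    (Measurable.ite measurableSet_Ioi measurable_const measurable_const)

theorem abs_realSign_le_one (r : ℝ) : |Real.sign r| ≤ 1 := by
  rcases Real.sign_apply_eq r with h | h | h <;> simp [h]

theorem realSign_mul_of_pos {c : ℝ} (hc : 0 < c) (y : ℝ) : Real.sign (c * y) = Real.sign y := by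
  rcases lt_trichotomy y 0 with h | rfl | h
  · rw [Real.sign_of_neg h, Real.sign_of_neg (mul_neg_of_pos_of_neg hc h)]
  · rw [mul_zero]
  · rw [Real.sign_of_pos h, Real.sign_of_pos (mul_pos hc h)]

theorem norm_cexp_I_mul_ofReal (r : ℝ) : ‖Complex.exp (Complex.I * (r : ℂ))‖ = 1 := by
  rw [mul_comm]; exact Complex.norm_exp_ofReal_mul_I r

namespace IsEvenSpectralKernel

variable {k φ ψ : ℝ → ℝ}

theorem integrable_scaled (hk : IsEvenSpectralKernel k φ ψ) {c : ℝ} (hc : 0 < c) :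
    Integrable fun η : ℝ => c⁻¹ * k (|η| / c) := by
  have h := (hk.integrable.comp_div hc.ne').const_mul c⁻¹
  refine h.congr (Eventually.of_forall fun η => ?_)
  simp only
  rw [← hk.abs (η / c), abs_div, abs_of_pos hc]

theorem integral_scaled {E : Type*} [NormedAddCommGroup E] [NormedSpace ℝ E]
    {c : ℝ} (hc : 0 < c) (G : ℝ → E) :
    ∫ η : ℝ, c⁻¹ • G (η / c) = ∫ y : ℝ, G y := by
  rw [integral_smul, Measure.integral_comp_div, smul_smul, abs_of_pos hc,
    inv_mul_cancel₀ hc.ne', one_smul]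

theorem fourier_scaled (hk : IsEvenSpectralKernel k φ ψ) {c : ℝ} (hc : 0 < c) (u : ℝ) :
    ∫ η : ℝ, Complex.exp (Complex.I * ((u * η : ℝ) : ℂ)) * ((c⁻¹ * k (|η| / c) : ℝ) : ℂ) =
      (φ (c * u) : ℂ) := by
  rw [← hk.fourier, ← integral_scaled hc fun y : ℝ =>
    Complex.exp (Complex.I * ((c * u * y : ℝ) : ℂ)) * (k y : ℂ)]
  congr 1
  ext η
  rw [← hk.abs (η / c), abs_div, abs_of_pos hc,
    show c * u * (η / c) = u * η by field_simp, Complex.real_smul]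
  push_cast
  ring

theorem signFourier_scaled (hk : IsEvenSpectralKernel k φ ψ) {c : ℝ} (hc : 0 < c) (u : ℝ) :
    ∫ η : ℝ, Complex.exp (Complex.I * ((u * η : ℝ) : ℂ)) *
      ((Real.sign η * (c⁻¹ * k (|η| / c)) : ℝ) : ℂ) = Complex.I * (ψ (c * u) : ℂ) := by
  rw [← hk.signFourier, ← integral_scaled hc fun y : ℝ =>
    Complex.exp (Complex.I * ((c * u * y : ℝ) : ℂ)) * ((Real.sign y * k y : ℝ) : ℂ)]
  congr 1
  ext η
  rw [← hk.abs (η / c), abs_div, abs_of_pos hc,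
    show c * u * (η / c) = u * η by field_simp, Complex.real_smul,
    show Real.sign (η / c) = Real.sign η by
      rw [div_eq_inv_mul, realSign_mul_of_pos (inv_pos.2 hc)]]
  push_cast
  ring

/-- Linearity in the two transforms of `k`; the constant `a` will be `ξ sign⟨x, x̃⟩`, which does not
depend on `η`. -/
theorem asymFourier_scaled (hk : IsEvenSpectralKernel k φ ψ) {c : ℝ} (hc : 0 < c) (u a : ℝ) :
    ∫ η : ℝ, Complex.exp (Complex.I * ((u * η : ℝ) : ℂ)) *
      ((c⁻¹ * k (|η| / c) * (1 + a * Real.sign η) : ℝ) : ℂ) =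
        (φ (c * u) : ℂ) + Complex.I * ((a * ψ (c * u) : ℝ) : ℂ) := by
  have hm : Measurable fun η : ℝ => Complex.exp (Complex.I * ((u * η : ℝ) : ℂ)) := by fun_prop
  have h1 : Integrable fun η : ℝ =>
      Complex.exp (Complex.I * ((u * η : ℝ) : ℂ)) * ((c⁻¹ * k (|η| / c) : ℝ) : ℂ) :=
    (hk.integrable_scaled hc).ofReal.bdd_mul (c := 1) hm.aestronglyMeasurable
      (Eventually.of_forall fun η => (norm_cexp_I_mul_ofReal _).le)
  have h2 : Integrable fun η : ℝ => Complex.exp (Complex.I * ((u * η : ℝ) : ℂ)) *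
      ((Real.sign η * (c⁻¹ * k (|η| / c)) : ℝ) : ℂ) :=
    ((hk.integrable_scaled hc).bdd_mul (c := 1) measurable_realSign.aestronglyMeasurable
      (Eventually.of_forall fun η => abs_realSign_le_one _)).ofReal.bdd_mul (c := 1)
      hm.aestronglyMeasurable (Eventually.of_forall fun η => (norm_cexp_I_mul_ofReal _).le)
  have h3 := integral_add h1 (h2.const_mul (a : ℂ))
  rw [integral_const_mul, hk.fourier_scaled hc, hk.signFourier_scaled hc] at h3
  rw [show (φ (c * u) : ℂ) + Complex.I * ((a * ψ (c * u) : ℝ) : ℂ) =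
    (φ (c * u) : ℂ) + a * (Complex.I * (ψ (c * u) : ℂ)) by push_cast; ring, ← h3]
  congr 1
  ext η
  push_cast
  ring

end IsEvenSpectralKernel

/-! ### Mixture densities and Fubini -/

/-- The radial spectral density `A exp (-β r²) κ(r)⁻¹ k (s / κ(r))`. -/
noncomputable def mixtureDensity (A β : ℝ) (κ k : ℝ → ℝ) (r s : ℝ) : ℝ :=
  A * Real.exp (-(β * r ^ 2)) * ((κ r)⁻¹ * k (s / κ r))

section Mixture

variable {d : ℕ} {A β : ℝ} {κ k φ ψ : ℝ → ℝ}

theorem integrable_exp_neg_mul_norm_sq (d : ℕ) {β : ℝ} (hβ : 0 < β) :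
    Integrable fun x : EuclideanSpace ℝ (Fin d) => Real.exp (-(β * ‖x‖ ^ 2)) := by
  have h := (GaussianFourier.integrable_cexp_neg_mul_sq_norm_add (V := EuclideanSpace ℝ (Fin d))
    (b := (β : ℂ)) (by simpa using hβ) 0 0).norm
  refine h.congr (Eventually.of_forall fun x => ?_)
  simp only [Complex.norm_exp]
  congr 1
  simp [← Complex.ofReal_pow, ← Complex.ofReal_mul, ← Complex.ofReal_neg]

/-- A unit vector forces `d ≥ 1`, so the origin is a null set. It must be discarded because `κ` may
vanish at `0`. -/
theorem ae_ne_zero_of_unit_vector {xt : EuclideanSpace ℝ (Fin d)} (hxt : ‖xt‖ = 1) :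
    ∀ᵐ x : EuclideanSpace ℝ (Fin d), x ≠ 0 := by
  have : Nontrivial (EuclideanSpace ℝ (Fin d)) :=
    ⟨xt, 0, fun h => by simp [h] at hxt⟩
  exact Measure.ae_ne volume 0

theorem measurable_mixtureDensity (hκ : Continuous κ) (hk : Continuous k) :
    Measurable fun p : EuclideanSpace ℝ (Fin d) × ℝ => mixtureDensity A β κ k ‖p.1‖ |p.2| := by
  unfold mixtureDensity
  have := hκ.measurable
  have := hk.measurable
  fun_prop

/-- Dilation preserves the mass of `k`, so integrating out `η` leaves a constant times a Gaussian in
`x`. -/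
theorem integrable_mixtureDensity (hk : IsEvenSpectralKernel k φ ψ) (hA : 0 ≤ A) (hβ : 0 < β)
    (hκ : Continuous κ) (hκ0 : ∀ r, 0 < r → 0 < κ r)
    (hd : ∀ᵐ x : EuclideanSpace ℝ (Fin d), x ≠ 0) :
    Integrable fun p : EuclideanSpace ℝ (Fin d) × ℝ => mixtureDensity A β κ k ‖p.1‖ |p.2| := by
  rw [Measure.volume_eq_prod, integrable_prod_iff
    (measurable_mixtureDensity hκ hk.continuous).aestronglyMeasurable]
  refine ⟨?_, ?_⟩
  · filter_upwards [hd] with x hx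
    exact (hk.integrable_scaled (hκ0 _ (norm_pos_iff.2 hx))).const_mul _
  · refine ((integrable_exp_neg_mul_norm_sq d hβ).const_mul (A * ∫ y, k y)).congr ?_
    filter_upwards [hd] with x hx
    have hc := hκ0 _ (norm_pos_iff.2 hx)
    have e : ∀ η : ℝ, ‖mixtureDensity A β κ k ‖x‖ |η|‖ =
        A * Real.exp (-(β * ‖x‖ ^ 2)) * ((κ ‖x‖)⁻¹ • k (η / κ ‖x‖)) := by
      intro η
      have := hk.nonneg (|η| / κ ‖x‖)
      rw [Real.norm_of_nonneg (by unfold mixtureDensity; positivity), mixtureDensity,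
        ← hk.abs (η / κ ‖x‖), abs_div, abs_of_pos hc, smul_eq_mul]
    simp only [e]
    rw [integral_const_mul, IsEvenSpectralKernel.integral_scaled hc]
    ring

theorem norm_one_add_mul_sign_le (ξ a b : ℝ) :
    |1 + ξ * Real.sign a * Real.sign b| ≤ 1 + |ξ| := by
  refine (abs_add_le _ _).trans ?_
  rw [abs_one, abs_mul, abs_mul]
  gcongr
  calc |ξ| * |Real.sign a| * |Real.sign b| ≤ |ξ| * 1 * 1 := by
        gcongr <;> exact abs_realSign_le_one _
    _ = |ξ| := by ring

theorem integrable_asym_integrand {f : EuclideanSpace ℝ (Fin d) × ℝ → ℝ} (hf : Integrable f)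
    (ξ : ℝ) (xt h : EuclideanSpace ℝ (Fin d)) (u : ℝ) :
    Integrable fun p : EuclideanSpace ℝ (Fin d) × ℝ =>
      Complex.exp (Complex.I * ((inner ℝ h p.1 : ℝ) + u * p.2 : ℝ)) *
        ((f p * (1 + ξ * Real.sign (inner ℝ p.1 xt) * Real.sign p.2) : ℝ) : ℂ) := by
  have hs := measurable_realSign
  have hm : Measurable fun p : EuclideanSpace ℝ (Fin d) × ℝ =>
      1 + ξ * Real.sign (inner ℝ p.1 xt) * Real.sign p.2 := by
    have h1 : Measurable fun p : EuclideanSpace ℝ (Fin d) × ℝ => (inner ℝ p.1 xt : ℝ) :=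
      (by fun_prop : Continuous fun p : EuclideanSpace ℝ (Fin d) × ℝ =>
        (inner ℝ p.1 xt : ℝ)).measurable
    exact ((measurable_const.mul (hs.comp h1)).mul (hs.comp measurable_snd)).const_add 1
  have hc : Continuous fun p : EuclideanSpace ℝ (Fin d) × ℝ =>
      Complex.exp (Complex.I * ((inner ℝ h p.1 : ℝ) + u * p.2 : ℝ)) := by fun_prop
  refine Integrable.bdd_mul (c := 1) ?_ hc.aestronglyMeasurable
    (Eventually.of_forall fun p => (norm_cexp_I_mul_ofReal _).le)
  exact (hf.mul_bdd (c := 1 + |ξ|) hm.aestronglyMeasurable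
    (Eventually.of_forall fun p => norm_one_add_mul_sign_le _ _ _)).ofReal

theorem integral_asym_mixture (hk : IsEvenSpectralKernel k φ ψ)
    (hκ0 : ∀ r, 0 < r → 0 < κ r) (σ ξ : ℝ) (xt h x : EuclideanSpace ℝ (Fin d)) (u : ℝ)
    (hx : x ≠ 0) :
    ∫ η : ℝ, Complex.exp (Complex.I * ((inner ℝ h x : ℝ) + u * η : ℝ)) *
        ((σ * mixtureDensity A β κ k ‖x‖ |η| *
          (1 + ξ * Real.sign (inner ℝ x xt) * Real.sign η) : ℝ) : ℂ) =
      σ * (Complex.exp (Complex.I * (inner ℝ h x : ℝ)) *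
        (((A * Real.exp (-(β * ‖x‖ ^ 2)) : ℝ) : ℂ) * ((φ (κ ‖x‖ * u) : ℂ) +
          Complex.I * ((ξ * Real.sign (inner ℝ x xt) * ψ (κ ‖x‖ * u) : ℝ) : ℂ)))) := by
  rw [← hk.asymFourier_scaled (hκ0 _ (norm_pos_iff.2 hx)), ← integral_const_mul,
    ← integral_const_mul, ← integral_const_mul]
  congr 1
  ext η
  rw [Complex.ofReal_add, mul_add, Complex.exp_add]
  unfold mixtureDensity
  push_cast
  ring

/-- Fubini: the asymmetric covariance of a mixture density. -/
theorem asymCovariance_mixture (hk : IsEvenSpectralKernel k φ ψ) (hA : 0 ≤ A) (hβ : 0 < β)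
    (hκ : Continuous κ) (hκ0 : ∀ r, 0 < r → 0 < κ r)
    (hd : ∀ᵐ x : EuclideanSpace ℝ (Fin d), x ≠ 0) (σ ξ : ℝ)
    (xt h : EuclideanSpace ℝ (Fin d)) (u : ℝ) :
    asymCovariance σ ξ xt (mixtureDensity A β κ k) h u =
      σ * ∫ x : EuclideanSpace ℝ (Fin d), Complex.exp (Complex.I * (inner ℝ h x : ℝ)) *
        (((A * Real.exp (-(β * ‖x‖ ^ 2)) : ℝ) : ℂ) * ((φ (κ ‖x‖ * u) : ℂ) +
          Complex.I * ((ξ * Real.sign (inner ℝ x xt) * ψ (κ ‖x‖ * u) : ℝ) : ℂ))) := by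
  have hI := integrable_asym_integrand
    ((integrable_mixtureDensity hk hA hβ hκ hκ0 hd).const_mul σ) ξ xt h u
  rw [Measure.volume_eq_prod] at hI
  unfold asymCovariance asymSpectralDensity
  rw [← integral_const_mul, ← integral_integral_swap (f := fun x η =>
    Complex.exp (Complex.I * ((inner ℝ h x : ℝ) + u * η : ℝ)) *
        ((σ * mixtureDensity A β κ k ‖x‖ |η| *
          (1 + ξ * Real.sign (inner ℝ x xt) * Real.sign η) : ℝ) : ℂ)) hI]
  refine integral_congr_ae ?_
  filter_upwards [hd] with x hx
  exact integral_asym_mixture hk hκ0 σ ξ xt h x u hx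

/-- The function is the `η`-marginal of an integrable function on the product (take `h = 0`, `σ =
1`), so no growth estimate on `ψ` is needed. -/
theorem integrable_halfSpectral_mixture (hk : IsEvenSpectralKernel k φ ψ) (hA : 0 ≤ A)
    (hβ : 0 < β) (hκ : Continuous κ) (hκ0 : ∀ r, 0 < r → 0 < κ r)
    (hd : ∀ᵐ x : EuclideanSpace ℝ (Fin d), x ≠ 0) (ξ : ℝ)
    (xt : EuclideanSpace ℝ (Fin d)) (u : ℝ) :
    Integrable fun x : EuclideanSpace ℝ (Fin d) =>
      ((A * Real.exp (-(β * ‖x‖ ^ 2)) : ℝ) : ℂ) * ((φ (κ ‖x‖ * u) : ℂ) +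
          Complex.I * ((ξ * Real.sign (inner ℝ x xt) * ψ (κ ‖x‖ * u) : ℝ) : ℂ)) := by
  have hI := integrable_asym_integrand
    ((integrable_mixtureDensity hk hA hβ hκ hκ0 hd).const_mul 1) ξ xt 0 u
  rw [Measure.volume_eq_prod] at hI
  refine hI.integral_prod_left.congr ?_
  filter_upwards [hd] with x hx
  have := integral_asym_mixture (A := A) (β := β) hk hκ0 1 ξ xt 0 x u hx
  simp only [this]
  simp

end Mixture

/-! ### Uniqueness of the spectral density -/

/-- Nonnegative integrable functions on `ℝᵈ × ℝ` are determined by their Fourier transforms. -/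
theorem ae_eq_of_fourier_eq {d : ℕ} {f g : EuclideanSpace ℝ (Fin d) → ℝ → ℝ}
    (hf0 : ∀ x η, 0 ≤ f x η) (hg0 : ∀ x η, 0 ≤ g x η)
    (hf : Integrable fun p : EuclideanSpace ℝ (Fin d) × ℝ => f p.1 p.2)
    (hg : Integrable fun p : EuclideanSpace ℝ (Fin d) × ℝ => g p.1 p.2)
    (hfg : ∀ h u, ∫ η : ℝ, ∫ x : EuclideanSpace ℝ (Fin d),
        Complex.exp (Complex.I * ((inner ℝ h x : ℝ) + u * η : ℝ)) * (f x η : ℂ) =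
      ∫ η : ℝ, ∫ x : EuclideanSpace ℝ (Fin d),
        Complex.exp (Complex.I * ((inner ℝ h x : ℝ) + u * η : ℝ)) * (g x η : ℂ)) :
    (fun p : EuclideanSpace ℝ (Fin d) × ℝ => f p.1 p.2) =ᵐ[volume] fun p => g p.1 p.2 := by
  have char : ∀ {q : EuclideanSpace ℝ (Fin d) → ℝ → ℝ} (_ : ∀ x η, 0 ≤ q x η)
      (_ : Integrable fun p : EuclideanSpace ℝ (Fin d) × ℝ => q p.1 p.2)
      (L : StrongDual ℝ (EuclideanSpace ℝ (Fin d) × ℝ)),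
      charFunDual (volume.withDensity fun p : EuclideanSpace ℝ (Fin d) × ℝ =>
        ENNReal.ofReal (q p.1 p.2)) L = ∫ η : ℝ, ∫ x : EuclideanSpace ℝ (Fin d),
        Complex.exp (Complex.I * ((inner ℝ ((InnerProductSpace.toDual ℝ _).symm
          (L.comp (ContinuousLinearMap.inl ℝ _ _))) x : ℝ) + L (0, 1) * η : ℝ)) *
          (q x η : ℂ) := by
    intro q hq0 hq L
    -- By Riesz, every functional on the product is a phase `⟨h, x⟩ + u η`, so the iterated
    -- integrals are the characteristic functional of the measure with density `q`.
    have e : ∀ p : EuclideanSpace ℝ (Fin d) × ℝ, L p =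
        (inner ℝ ((InnerProductSpace.toDual ℝ _).symm
          (L.comp (ContinuousLinearMap.inl ℝ _ _))) p.1 : ℝ) + L (0, 1) * p.2 := by
      intro p
      rw [InnerProductSpace.toDual_symm_apply]
      have : p = (p.1, 0) + p.2 • ((0, 1) : EuclideanSpace ℝ (Fin d) × ℝ) := by
        ext <;> simp
      conv_lhs => rw [this, map_add, map_smul]
      simp [mul_comm]
    have hI : Integrable (fun p : EuclideanSpace ℝ (Fin d) × ℝ =>
        Complex.exp (Complex.I * (L p : ℂ)) * (q p.1 p.2 : ℂ)) := by
      refine hq.ofReal.bdd_mul (c := 1) ?_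
        (Eventually.of_forall fun η => (norm_cexp_I_mul_ofReal _).le)
      exact (by fun_prop : Continuous fun p : EuclideanSpace ℝ (Fin d) × ℝ =>
        Complex.exp (Complex.I * (L p : ℂ))).aestronglyMeasurable
    rw [charFunDual_apply, integral_withDensity_eq_integral_toReal_smul₀
      hq.1.aemeasurable.ennreal_ofReal (Eventually.of_forall fun p => ENNReal.ofReal_lt_top)]
    have : ∀ p : EuclideanSpace ℝ (Fin d) × ℝ, (ENNReal.ofReal (q p.1 p.2)).toReal •
        Complex.exp ((L p : ℂ) * Complex.I) =
        Complex.exp (Complex.I * (L p : ℂ)) * (q p.1 p.2 : ℂ) := by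
      intro p
      rw [ENNReal.toReal_ofReal (hq0 _ _), Complex.real_smul, mul_comm, mul_comm Complex.I]
    simp only [this]
    rw [Measure.volume_eq_prod] at hI ⊢
    rw [integral_prod_symm _ hI]
    congr 1
    ext η
    congr 1
    ext x
    rw [e (x, η)]
  have fin : ∀ {q : EuclideanSpace ℝ (Fin d) → ℝ → ℝ}
      (_ : Integrable fun p : EuclideanSpace ℝ (Fin d) × ℝ => q p.1 p.2),
      IsFiniteMeasure (volume.withDensity fun p : EuclideanSpace ℝ (Fin d) × ℝ =>
        ENNReal.ofReal (q p.1 p.2)) := fun hq => isFiniteMeasure_withDensity_ofReal hq.2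
  have := fin hf
  have := fin hg
  have key := Measure.ext_of_charFunDual (funext fun L =>
    ((char hf0 hf L).trans (hfg _ _)).trans (char hg0 hg L).symm)
  rw [withDensity_eq_iff_of_sigmaFinite hf.1.aemeasurable.ennreal_ofReal
    hg.1.aemeasurable.ennreal_ofReal] at key
  filter_upwards [key] with p hp
  exact (ENNReal.ofReal_eq_ofReal_iff (hf0 _ _) (hg0 _ _)).1 hp

theorem asymCovariance_congr {d : ℕ} {σ : ℝ} {f g : ℝ → ℝ → ℝ}
    (hfg : (fun p : EuclideanSpace ℝ (Fin d) × ℝ => σ * f ‖p.1‖ |p.2|) =ᵐ[volume]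
      fun p => σ * g ‖p.1‖ |p.2|) (ξ : ℝ) (xt h : EuclideanSpace ℝ (Fin d)) (u : ℝ) :
    asymCovariance σ ξ xt f h u = asymCovariance σ ξ xt g h u := by
  have h2 : ∀ᵐ η : ℝ, ∀ᵐ x : EuclideanSpace ℝ (Fin d), σ * f ‖x‖ |η| = σ * g ‖x‖ |η| := by
    have h1 := (Measure.measurePreserving_swap (μ := (volume : Measure ℝ))
      (ν := (volume : Measure (EuclideanSpace ℝ (Fin d))))).quasiMeasurePreserving.ae hfg
    exact Measure.ae_ae_of_ae_prod h1
  refine integral_congr_ae ?_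
  filter_upwards [h2] with η hη
  refine integral_congr_ae ?_
  filter_upwards [hη] with x hx
  simp only [asymSpectralDensity, hx]

/-! ### The representation for a general kernel -/

/-- The half-spectral representation for a mixture density. -/
theorem halfSpectral_representation {d : ℕ} {A β σ ξ : ℝ} {κ k φ ψ : ℝ → ℝ}
    (hk : IsEvenSpectralKernel k φ ψ) (hA : 0 ≤ A) (hβ : 0 < β) (hσ : 0 ≤ σ)
    (hκ : Continuous κ) (hκ0 : ∀ r, 0 < r → 0 < κ r)
    {xt : EuclideanSpace ℝ (Fin d)} (hxt : ‖xt‖ = 1)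
    {C : EuclideanSpace ℝ (Fin d) → ℝ → ℝ}
    (hC : ∀ h u, (C h u : ℂ) = σ * ∫ x : EuclideanSpace ℝ (Fin d),
      Complex.exp (Complex.I * (inner ℝ h x : ℝ)) *
        ((A * Real.exp (-(β * ‖x‖ ^ 2)) * φ (κ ‖x‖ * u) : ℝ) : ℂ))
    {H : EuclideanSpace ℝ (Fin d) → ℝ → ℂ}
    (hH : ∀ x u, H x u = ((A * Real.exp (-(β * ‖x‖ ^ 2)) : ℝ) : ℂ) * ((φ (κ ‖x‖ * u) : ℂ) +
          Complex.I * ((ξ * Real.sign (inner ℝ x xt) * ψ (κ ‖x‖ * u) : ℝ) : ℂ))) :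
    (∃ fstar : ℝ → ℝ → ℝ, IsSpaceTimeSpectralDensity C (fun x η => σ * fstar ‖x‖ |η|)) ∧
      ∀ fstar : ℝ → ℝ → ℝ, IsSpaceTimeSpectralDensity C (fun x η => σ * fstar ‖x‖ |η|) →
        ∀ (h : EuclideanSpace ℝ (Fin d)) (u : ℝ), Integrable (fun x => H x u) ∧
          asymCovariance σ ξ xt fstar h u = σ * ∫ x : EuclideanSpace ℝ (Fin d),
            Complex.exp (Complex.I * (inner ℝ h x : ℝ)) * H x u := by
  have hd := ae_ne_zero_of_unit_vector hxt
  have hg : IsSpaceTimeSpectralDensity C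
      (fun x η => σ * mixtureDensity A β κ k ‖x‖ |η|) := by
    refine ⟨fun x η => ?_, fun x η => by simp,
      (integrable_mixtureDensity hk hA hβ hκ hκ0 hd).const_mul σ, fun h u => ?_⟩
    · rcases eq_or_ne x 0 with rfl | hx
      -- Nonnegativity is required at every point, including the origin, where `κ` is only known as
      -- a limit of positive values.
      · have h0 : 0 ≤ κ 0 := by
          refine ge_of_tendsto (hκ.continuousWithinAt (s := Set.Ioi 0) (x := 0)) ?_
          filter_upwards [self_mem_nhdsWithin] with r hr using (hκ0 r hr).le
        have := hk.nonneg (|η| / κ 0)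
        rw [norm_zero]
        unfold mixtureDensity
        positivity
      · have := hκ0 _ (norm_pos_iff.2 hx)
        have := hk.nonneg (|η| / κ ‖x‖)
        unfold mixtureDensity
        positivity
    -- With `ξ = 0` the asymmetric formula is the Bochner representation.
    · have := asymCovariance_mixture hk hA hβ hκ hκ0 hd σ 0 xt h u
      rw [hC]
      unfold asymCovariance asymSpectralDensity at this
      simp only [zero_mul, add_zero, mul_one, Complex.ofReal_zero, mul_zero] at this
      rw [this]
      refine congrArg _ (integral_congr_ae (Eventually.of_forall fun x => ?_))
      push_cast
      ring
  refine ⟨⟨_, hg⟩, fun fstar hf h u => ⟨?_, ?_⟩⟩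
  · simp only [hH]
    exact integrable_halfSpectral_mixture hk hA hβ hκ hκ0 hd ξ xt u
  · simp only [hH]
    rw [← asymCovariance_mixture hk hA hβ hκ hκ0 hd]
    exact asymCovariance_congr (ae_eq_of_fourier_eq hf.nonneg hg.nonneg hf.integrable hg.integrable
      fun h u => (hf.bochner h u).symm.trans (hg.bochner h u)) ξ xt h u

/-! ### Sine transform of the Gaussian -/

/-- Folding an integral over the line onto the half-line. -/
theorem integral_eq_integral_Ioi_add_neg {E : Type*} [NormedAddCommGroup E] [NormedSpace ℝ E]
    {f : ℝ → E} (hf : Integrable f) :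
    ∫ y, f y = ∫ y in Set.Ioi (0 : ℝ), (f y + f (-y)) := by
  have h1 := integral_comp_neg_Ioi (0 : ℝ) f
  rw [neg_zero] at h1
  rw [integral_add hf.integrableOn hf.comp_neg.integrableOn, h1, add_comm,
    intervalIntegral.integral_Iic_add_Ioi hf.integrableOn hf.integrableOn]

/-- Pairing `y` with `-y`, the odd sign leaves `exp(ivy) - exp(-ivy) = 2i sin(vy)`. -/
theorem integral_sign_fourier {k : ℝ → ℝ} (hk : Integrable k) (habs : ∀ y, k |y| = k y) (v : ℝ) :
    ∫ y : ℝ, Complex.exp (Complex.I * ((v * y : ℝ) : ℂ)) * ((Real.sign y * k y : ℝ) : ℂ) =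
      Complex.I * ((2 * ∫ y in Set.Ioi (0 : ℝ), Real.sin (v * y) * k y : ℝ) : ℂ) := by
  have hm : Measurable fun η : ℝ => Complex.exp (Complex.I * ((v * η : ℝ) : ℂ)) := by fun_prop
  have h2 : Integrable fun y : ℝ => Complex.exp (Complex.I * ((v * y : ℝ) : ℂ)) *
      ((Real.sign y * k y : ℝ) : ℂ) :=
    (hk.bdd_mul (c := 1) measurable_realSign.aestronglyMeasurable
      (Eventually.of_forall fun η => abs_realSign_le_one _)).ofReal.bdd_mul (c := 1)
      hm.aestronglyMeasurable (Eventually.of_forall fun η => (norm_cexp_I_mul_ofReal _).le)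
  rw [integral_eq_integral_Ioi_add_neg h2, ← integral_const_mul, ← integral_complex_ofReal,
    ← integral_const_mul]
  refine setIntegral_congr_fun measurableSet_Ioi fun y hy => ?_
  have hy : 0 < y := hy
  have e : k (-y) = k y := by rw [← habs, abs_neg, habs]
  rw [e, Real.sign_neg, Real.sign_of_pos hy, mul_comm Complex.I, mul_comm Complex.I,
    Complex.exp_mul_I, Complex.exp_mul_I]
  push_cast
  rw [mul_neg, Complex.cos_neg, Complex.sin_neg]
  ring

theorem integrable_exp_neg_sq_div_four : Integrable fun y : ℝ => Real.exp (-(y ^ 2 / 4)) := by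
  refine (integrable_exp_neg_mul_sq (b := 1 / 4) (by norm_num)).congr
    (Eventually.of_forall fun y => ?_)
  simp only
  congr 1
  ring

theorem integrable_mul_exp_neg_sq_div_four :
    Integrable fun y : ℝ => y * Real.exp (-(y ^ 2 / 4)) := by
  refine (integrable_mul_exp_neg_mul_sq (b := 1 / 4) (by norm_num)).congr
    (Eventually.of_forall fun y => ?_)
  simp only
  congr 2
  ring

/-- Integration by parts with the antiderivative `-2 exp(-y²/4)` of `y exp(-y²/4)`; the boundary
term at `0` is the `2`. -/
theorem integral_mul_cos_mul_gaussian (v : ℝ) :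
    ∫ y in Set.Ioi (0 : ℝ), y * Real.exp (-(y ^ 2 / 4)) * Real.cos (v * y) =
      2 - 2 * v * ∫ y in Set.Ioi (0 : ℝ), Real.sin (v * y) * Real.exp (-(y ^ 2 / 4)) := by
  have i1 : Integrable fun y : ℝ => y * Real.exp (-(y ^ 2 / 4)) * Real.cos (v * y) :=
    integrable_mul_exp_neg_sq_div_four.mul_bdd (c := 1)
      (by fun_prop : Continuous fun y : ℝ => Real.cos (v * y)).aestronglyMeasurable
      (Eventually.of_forall fun y => Real.abs_cos_le_one _)
  have i2 : Integrable fun y : ℝ => Real.sin (v * y) * Real.exp (-(y ^ 2 / 4)) :=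
    integrable_exp_neg_sq_div_four.bdd_mul (c := 1)
      (by fun_prop : Continuous fun y : ℝ => Real.sin (v * y)).aestronglyMeasurable
      (Eventually.of_forall fun y => Real.abs_sin_le_one _)
  have key : ∫ y in Set.Ioi (0 : ℝ), (y * Real.exp (-(y ^ 2 / 4)) * Real.cos (v * y) +
      2 * v * (Real.sin (v * y) * Real.exp (-(y ^ 2 / 4)))) =
      0 - (-2 * Real.exp (-((0 : ℝ) ^ 2 / 4)) * Real.cos (v * 0)) := by
    refine integral_Ioi_of_hasDerivAt_of_tendsto'
      (f := fun y => -2 * Real.exp (-(y ^ 2 / 4)) * Real.cos (v * y)) (fun y _ => ?_)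
      (i1.add (i2.const_mul _)).integrableOn ?_
    · have h1 : HasDerivAt (fun y : ℝ => -(y ^ 2 / 4)) (-(y / 2)) y := by
        convert! ((hasDerivAt_pow 2 y).div_const 4).neg using 1
        simp; ring
      have h2 : HasDerivAt (fun y : ℝ => v * y) v y := by
        simpa using (hasDerivAt_id y).const_mul v
      convert! (h1.exp.const_mul (-2)).mul h2.cos using 1
      ring
    · have h0 : Tendsto (fun y : ℝ => Real.exp (-(y ^ 2 / 4))) atTop (𝓝 0) :=
        Real.tendsto_exp_neg_atTop_nhds_zero.comp
          ((tendsto_pow_atTop two_ne_zero).atTop_div_const (by norm_num))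
      have h1 : Tendsto (fun y : ℝ => -2 * Real.exp (-(y ^ 2 / 4))) atTop (𝓝 0) := by
        simpa using h0.const_mul (-2)
      refine h1.zero_mul_isBoundedUnder_le ?_
      exact isBoundedUnder_of ⟨1, fun y => Real.abs_cos_le_one _⟩
  rw [integral_add i1.integrableOn (i2.const_mul _).integrableOn, integral_const_mul] at key
  simp at key
  linarith

theorem hasDerivAt_integral_sin_mul_gaussian (v : ℝ) :
    HasDerivAt (fun v : ℝ => ∫ y in Set.Ioi (0 : ℝ), Real.sin (v * y) * Real.exp (-(y ^ 2 / 4)))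
      (2 - 2 * v * ∫ y in Set.Ioi (0 : ℝ), Real.sin (v * y) * Real.exp (-(y ^ 2 / 4))) v := by
  rw [← integral_mul_cos_mul_gaussian]
  refine (hasDerivAt_integral_of_dominated_loc_of_deriv_le (s := Set.univ)
    (bound := fun y => ‖y * Real.exp (-(y ^ 2 / 4))‖)
    (F' := fun v y => y * Real.exp (-(y ^ 2 / 4)) * Real.cos (v * y)) univ_mem
    (Eventually.of_forall fun v => ?_) ?_ ?_ ?_ ?_ ?_).2
  · exact (by fun_prop : Continuous fun y : ℝ =>
      Real.sin (v * y) * Real.exp (-(y ^ 2 / 4))).aestronglyMeasurable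
  · exact (integrable_exp_neg_sq_div_four.bdd_mul (c := 1)
      (by fun_prop : Continuous fun y : ℝ => Real.sin (v * y)).aestronglyMeasurable
      (Eventually.of_forall fun y => Real.abs_sin_le_one _)).integrableOn
  · exact (by fun_prop : Continuous fun y : ℝ =>
      y * Real.exp (-(y ^ 2 / 4)) * Real.cos (v * y)).aestronglyMeasurable
  · refine Eventually.of_forall fun y v _ => ?_
    rw [norm_mul _ (Real.cos _)]
    exact mul_le_of_le_one_right (norm_nonneg _) (Real.abs_cos_le_one _)
  · exact integrable_mul_exp_neg_sq_div_four.norm.integrableOn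
  · refine Eventually.of_forall fun y v _ => ?_
    have h2 : HasDerivAt (fun v : ℝ => v * y) y v := by
      simpa using (hasDerivAt_id v).mul_const y
    convert! h2.sin.mul_const (Real.exp (-(y ^ 2 / 4))) using 1
    ring

/-- Dawson's integral. -/
theorem integral_sin_mul_gaussian (v : ℝ) :
    ∫ y in Set.Ioi (0 : ℝ), Real.sin (v * y) * Real.exp (-(y ^ 2 / 4)) =
      2 * Real.exp (-v ^ 2) * ∫ t in (0 : ℝ)..v, Real.exp (t ^ 2) := by
  set F : ℝ → ℝ := fun v => ∫ y in Set.Ioi (0 : ℝ), Real.sin (v * y) * Real.exp (-(y ^ 2 / 4))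
    with hF
  -- The ODE is `F' = 2 - 2vF`; with the integrating factor `exp(v²)` it becomes `(exp(v²) F)' = 2
  -- exp(v²)`, and `F 0 = 0`.
  have hd : ∀ v, HasDerivAt (fun v => Real.exp (v ^ 2) * F v -
      2 * ∫ t in (0 : ℝ)..v, Real.exp (t ^ 2)) 0 v := by
    intro v
    have h1 : HasDerivAt (fun v : ℝ => v ^ 2) (2 * v) v := by simpa using hasDerivAt_pow 2 v
    have h2 : HasDerivAt (fun v : ℝ => ∫ t in (0 : ℝ)..v, Real.exp (t ^ 2)) (Real.exp (v ^ 2)) v :=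
      ((by fun_prop : Continuous fun t : ℝ => Real.exp (t ^ 2)).integral_hasStrictDerivAt
        0 v).hasDerivAt
    convert! (h1.exp.mul (hasDerivAt_integral_sin_mul_gaussian v)).sub (h2.const_mul 2) using 1
    ring
  have hc := is_const_of_deriv_eq_zero (fun v => (hd v).differentiableAt)
    (fun v => (hd v).deriv) v 0
  simp only [intervalIntegral.integral_same, hF, zero_mul, Real.sin_zero, integral_zero,
    mul_zero, sub_zero] at hc
  have he : Real.exp (-v ^ 2) * Real.exp (v ^ 2) = 1 := by rw [← Real.exp_add]; simp
  calc F v = Real.exp (-v ^ 2) * Real.exp (v ^ 2) * F v := by rw [he, one_mul]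
    _ = _ := by linear_combination Real.exp (-v ^ 2) * hc

theorem isEvenSpectralKernel_gaussian :
    IsEvenSpectralKernel (fun y => (2 * Real.sqrt Real.pi)⁻¹ * Real.exp (-(y ^ 2 / 4)))
      (fun v => Real.exp (-v ^ 2)) (fun v => Real.exp (-v ^ 2) * realErfi v) where
  nonneg y := by positivity
  abs y := by simp
  continuous := by fun_prop
  integrable := integrable_exp_neg_sq_div_four.const_mul _
  fourier v := by
    have h := fourierIntegral_gaussian (b := 1 / 4) (by norm_num) (v : ℂ)
    have hs : ((Real.pi : ℂ) / (1 / 4)) ^ (1 / 2 : ℂ) = ((2 * Real.sqrt Real.pi : ℝ) : ℂ) := by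
      rw [show (Real.pi : ℂ) / (1 / 4) = ((4 * Real.pi : ℝ) : ℂ) by push_cast; ring,
        show (1 / 2 : ℂ) = ((1 / 2 : ℝ) : ℂ) by push_cast; ring,
        ← Complex.ofReal_cpow (by positivity), ← Real.sqrt_eq_rpow,
        Real.sqrt_mul (by norm_num), show (4 : ℝ) = 2 ^ 2 by norm_num,
        Real.sqrt_sq (by norm_num)]
    rw [hs] at h
    have hne : ((2 * Real.sqrt Real.pi : ℝ) : ℂ) ≠ 0 := by
      exact_mod_cast (by positivity : (2 * Real.sqrt Real.pi) ≠ 0)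
    calc _ = ∫ y : ℝ, ((2 * Real.sqrt Real.pi : ℝ) : ℂ)⁻¹ *
        (Complex.exp (Complex.I * v * y) * Complex.exp (-(1 / 4) * y ^ 2)) := by
          congr 1
          ext y
          push_cast
          ring_nf
      _ = _ := by
          rw [integral_const_mul, h, inv_mul_cancel_left₀ hne]
          push_cast
          congr 1
          ring
  signFourier v := by
    rw [integral_sign_fourier (integrable_exp_neg_sq_div_four.const_mul _) (fun y => by simp)]
    simp only [mul_left_comm _ (2 * Real.sqrt Real.pi)⁻¹]
    rw [integral_const_mul, integral_sin_mul_gaussian, realErfi]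
    congr 2
    field_simp

/-! ### Exponential integrals and the sine transform of the Cauchy density -/

theorem integrableOn_exp_neg_div_Ioi {z : ℝ} (hz : 0 < z) :
    IntegrableOn (fun t : ℝ => Real.exp (-t) / t) (Set.Ioi z) := by
  refine Integrable.mono' ((integrableOn_exp_neg_Ioi z).const_mul z⁻¹)
    (by fun_prop : Measurable fun t : ℝ => Real.exp (-t) / t).aestronglyMeasurable ?_
  refine (ae_restrict_iff' measurableSet_Ioi).2 (Eventually.of_forall fun t (ht : z < t) => ?_)
  have h0 : 0 < t := hz.trans ht
  rw [Real.norm_of_nonneg (by positivity), div_eq_inv_mul]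
  gcongr

/-- The singularity at `0` is removable: off `0` the quotient is a continuous `dslope`. -/
theorem intervalIntegrable_exp_sub_exp_neg_div (a b : ℝ) :
    IntervalIntegrable (fun t : ℝ => (Real.exp t - Real.exp (-t)) / t) volume a b := by
  have hcont : Continuous (fun t : ℝ => dslope (fun s => Real.exp s - Real.exp (-s)) 0 t) := by
    rw [continuous_iff_continuousAt]
    intro t
    by_cases ht : t = 0
    · subst ht
      exact continuousAt_dslope_same.2 (by fun_prop)
    · exact (continuousAt_dslope_of_ne ht).2 (by fun_prop)
  refine (hcont.intervalIntegrable a b).congr_ae (ae_restrict_of_ae ?_)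
  filter_upwards [Measure.ae_ne volume (0 : ℝ)] with t ht
  simp [dslope_of_ne _ ht, slope_def_field]

/-- `Ei z` as an absolutely convergent integral minus `E₁ z`. -/
theorem expIntegralEi_eq {z : ℝ} (hz : 0 < z) :
    expIntegralEi z =
      (∫ t in (0 : ℝ)..z, (Real.exp t - Real.exp (-t)) / t) - expIntegralE1 z := by
  refine tendsto_nhds_unique (tendsto_expIntegralEiCut hz) ?_
  have key : ∀ ε ∈ Set.Ioo (0 : ℝ) z, (∫ t in ε..z, (Real.exp t - Real.exp (-t)) / t) -
      expIntegralE1 z = expIntegralEiCut z ε := by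
    intro ε hε
    have hI : ∀ t ∈ Set.uIcc ε z, t ≠ 0 := by
      intro t ht
      rw [Set.uIcc_of_le hε.2.le] at ht
      exact (hε.1.trans_le ht.1).ne'
    have i1 : IntervalIntegrable (fun t : ℝ => Real.exp t / t) volume ε z :=
      (ContinuousOn.div (by fun_prop) (by fun_prop) hI).intervalIntegrable
    have i2 : IntervalIntegrable (fun t : ℝ => Real.exp (-t) / t) volume ε z :=
      (ContinuousOn.div (by fun_prop) (by fun_prop) hI).intervalIntegrable
    -- Reflecting the left tail, the symmetric cut cancels the two divergences at `0` against each
    -- other.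
    have e1 : (∫ t in Set.Iic (-ε), Real.exp t / t) = -∫ t in Set.Ioi ε, Real.exp (-t) / t := by
      rw [← integral_comp_neg_Ioi, ← integral_neg]
      congr 1
      ext t
      rw [div_neg]
    have e2 : (∫ t in Set.Ioi ε, Real.exp (-t) / t) =
        (∫ t in ε..z, Real.exp (-t) / t) + expIntegralE1 z :=
      (intervalIntegral.integral_interval_add_Ioi (integrableOn_exp_neg_div_Ioi hε.1)
        (integrableOn_exp_neg_div_Ioi hz)).symm
    simp only [sub_div]
    rw [expIntegralEiCut, e1, e2, intervalIntegral.integral_sub i1 i2]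
    ring
  have hc : Continuous fun ε : ℝ => ∫ t in ε..z, (Real.exp t - Real.exp (-t)) / t := by
    simp only [fun ε : ℝ => intervalIntegral.integral_symm (μ := volume)
      (f := fun t : ℝ => (Real.exp t - Real.exp (-t)) / t) z ε]
    exact (intervalIntegral.continuous_primitive intervalIntegrable_exp_sub_exp_neg_div z).neg
  refine Tendsto.congr' ?_ ((hc.sub continuous_const).continuousAt.tendsto.mono_left
    nhdsWithin_le_nhds)
  filter_upwards [Ioo_mem_nhdsGT hz] with ε hε
  exact key ε hε

theorem integral_exp_neg_mul_cexp {c : ℝ} (hc : 0 < c) (a : ℝ) :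
    ∫ y in Set.Ioi (0 : ℝ), (Real.exp (-(c * y)) : ℂ) * Complex.exp (Complex.I * ((a * y : ℝ) : ℂ))
      = ((c : ℂ) - Complex.I * a)⁻¹ := by
  have h := integral_exp_mul_complex_Ioi (a := -(c : ℂ) + Complex.I * a) (by simpa using hc) 0
  rw [show ((c : ℂ) - Complex.I * a)⁻¹ = -Complex.exp ((-(c : ℂ) + Complex.I * a) * (0 : ℝ)) /
    (-(c : ℂ) + Complex.I * a) by
      rw [Complex.ofReal_zero, mul_zero, Complex.exp_zero, neg_div, ← div_neg, one_div]
      congr 1; ring, ← h]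
  congr 1
  ext y
  rw [Complex.ofReal_exp, ← Complex.exp_add]
  congr 1
  push_cast
  ring

theorem integrableOn_exp_neg_mul {c : ℝ} (hc : 0 < c) :
    IntegrableOn (fun y : ℝ => Real.exp (-(c * y))) (Set.Ioi 0) := by
  simpa only [neg_mul] using integrableOn_exp_mul_Ioi (neg_lt_zero.2 hc) 0

theorem integrableOn_exp_neg_mul_cexp {c : ℝ} (hc : 0 < c) (a : ℝ) :
    IntegrableOn (fun y : ℝ => (Real.exp (-(c * y)) : ℂ) *
      Complex.exp (Complex.I * ((a * y : ℝ) : ℂ))) (Set.Ioi 0) := by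
  refine Integrable.mul_bdd (c := 1) (integrableOn_exp_neg_mul hc).ofReal
    (by fun_prop : Continuous fun y : ℝ =>
      Complex.exp (Complex.I * ((a * y : ℝ) : ℂ))).aestronglyMeasurable
    (Eventually.of_forall fun y => (norm_cexp_I_mul_ofReal _).le)

theorem inv_sub_I_mul (c a : ℝ) (hc : 0 < c) : ((c : ℂ) - Complex.I * a)⁻¹ =
    ((c / (c ^ 2 + a ^ 2) : ℝ) : ℂ) + Complex.I * ((a / (c ^ 2 + a ^ 2) : ℝ) : ℂ) := by
  have h1 : (c : ℂ) - Complex.I * a ≠ 0 := by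
    intro h
    have := congrArg Complex.re h
    simp at this
    exact hc.ne' this
  have h2 : (c : ℂ) ^ 2 + (a : ℂ) ^ 2 ≠ 0 := by
    exact_mod_cast (by positivity : c ^ 2 + a ^ 2 ≠ 0)
  rw [inv_eq_iff_eq_inv, eq_comm, inv_eq_iff_eq_inv, eq_comm, ← mul_right_inj' h1,
    mul_inv_cancel₀ h1]
  push_cast
  field_simp
  linear_combination (a : ℂ) ^ 2 * Complex.I_sq

theorem integral_exp_neg_mul_sin {c : ℝ} (hc : 0 < c) (a : ℝ) :
    ∫ y in Set.Ioi (0 : ℝ), Real.exp (-(c * y)) * Real.sin (a * y) = a / (c ^ 2 + a ^ 2) := by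
  have h := congrArg Complex.im ((integral_exp_neg_mul_cexp hc a).trans (inv_sub_I_mul c a hc))
  have h2 := integral_im (𝕜 := ℂ) (integrableOn_exp_neg_mul_cexp hc a)
  simp only [RCLike.im_to_complex] at h2
  rw [← h2] at h
  simp only [Complex.add_im, Complex.ofReal_im, Complex.I_mul_im, Complex.ofReal_re, zero_add,
    Complex.im_ofReal_mul] at h
  rw [← h]
  congr 1
  ext y
  rw [mul_comm Complex.I, Complex.exp_ofReal_mul_I_im]

theorem integral_exp_neg_mul_cos {c : ℝ} (hc : 0 < c) (a : ℝ) :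
    ∫ y in Set.Ioi (0 : ℝ), Real.exp (-(c * y)) * Real.cos (a * y) = c / (c ^ 2 + a ^ 2) := by
  have h := congrArg Complex.re ((integral_exp_neg_mul_cexp hc a).trans (inv_sub_I_mul c a hc))
  have h2 := integral_re (𝕜 := ℂ) (integrableOn_exp_neg_mul_cexp hc a)
  simp only [RCLike.re_to_complex] at h2
  rw [← h2] at h
  simp only [Complex.add_re, Complex.ofReal_im, Complex.I_mul_re, Complex.ofReal_re, neg_zero,
    add_zero, Complex.re_ofReal_mul] at h
  rw [← h]
  congr 1
  ext y
  rw [mul_comm Complex.I, Complex.exp_ofReal_mul_I_re]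

/-- Fubini for the damped sine transform of `1 / (1 + y²)`. -/
theorem integral_damped_sin_mul_cauchy {ε : ℝ} (hε : 0 < ε) (v : ℝ) :
    ∫ y in Set.Ioi (0 : ℝ), Real.exp (-(ε * y)) * (Real.sin (v * y) * (1 + y ^ 2)⁻¹) =
      1 / 2 * ∫ s in Set.Ioi (0 : ℝ), Real.exp (-s) *
        ((v + s) / (ε ^ 2 + (v + s) ^ 2) + (v - s) / (ε ^ 2 + (v - s) ^ 2)) := by
  -- The damping factor `exp(-εy)` supplies the decay in `y` that Fubini needs once `1/(1+y²)` is
  -- replaced by the integral of `exp(-s) cos(ys)`.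
  have hI : Integrable (fun p : ℝ × ℝ => Real.exp (-(ε * p.1)) * Real.exp (-(1 * p.2)) *
      (Real.sin (v * p.1) * Real.cos (p.1 * p.2)))
      ((volume.restrict (Set.Ioi 0)).prod (volume.restrict (Set.Ioi 0))) := by
    refine Integrable.mul_bdd (c := 1)
      (Integrable.mul_prod (integrableOn_exp_neg_mul hε) (integrableOn_exp_neg_mul one_pos))
      (by fun_prop : Continuous fun p : ℝ × ℝ =>
        Real.sin (v * p.1) * Real.cos (p.1 * p.2)).aestronglyMeasurable
      (Eventually.of_forall fun p => ?_)
    rw [norm_mul]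
    exact mul_le_one₀ (Real.abs_sin_le_one _) (norm_nonneg _) (Real.abs_cos_le_one _)
  have hs := integral_integral_swap (f := fun y s => Real.exp (-(ε * y)) * Real.exp (-(1 * s)) *
      (Real.sin (v * y) * Real.cos (y * s))) hI
  rw [← integral_const_mul]
  calc _ = ∫ y in Set.Ioi (0 : ℝ), ∫ s in Set.Ioi (0 : ℝ),
        Real.exp (-(ε * y)) * Real.exp (-(1 * s)) * (Real.sin (v * y) * Real.cos (y * s)) := by
        congr 1
        ext y
        have := integral_exp_neg_mul_cos one_pos y
        rw [one_pow, one_div] at this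
        rw [← this, ← mul_assoc, ← integral_const_mul]
        congr 1
        ext s
        ring
    _ = _ := by
        rw [hs]
        congr 1
        ext s
        -- Product to sum: `2 sin(vy) cos(sy) = sin((v+s)y) + sin((v-s)y)`.
        rw [← integral_exp_neg_mul_sin hε, ← integral_exp_neg_mul_sin hε, ← integral_add,
          ← integral_const_mul, ← integral_const_mul]
        · congr 1
          ext y
          rw [one_mul, add_mul, sub_mul, Real.sin_add, Real.sin_sub, mul_comm y s]
          ring
        all_goals
          exact (integrableOn_exp_neg_mul hε).mul_bdd (c := 1)
            (by fun_prop : Continuous _).aestronglyMeasurable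
            (Eventually.of_forall fun y => Real.abs_sin_le_one _)

theorem tendsto_div_sq_add_sq {t : ℝ} (ht : t ≠ 0) :
    Tendsto (fun ε : ℝ => t / (ε ^ 2 + t ^ 2)) (𝓝[>] 0) (𝓝 t⁻¹) := by
  have hc : ContinuousAt (fun ε : ℝ => t / (ε ^ 2 + t ^ 2)) 0 :=
    ContinuousAt.div (by fun_prop) (by fun_prop) (by simpa using ht)
  have := hc.tendsto.mono_left (nhdsWithin_le_nhds (s := Set.Ioi 0))
  convert! this using 2
  field_simp
  simp

theorem div_sq_add_sq_le {t : ℝ} (ht : 0 < t) (ε : ℝ) : t / (ε ^ 2 + t ^ 2) ≤ t⁻¹ := by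
  rw [inv_eq_one_div, div_le_div_iff₀ (by positivity) ht]
  nlinarith [sq_nonneg ε]

theorem tendsto_integral_exp_neg_mul_regularized {v : ℝ} (hv : 0 < v) :
    Tendsto (fun ε : ℝ => ∫ t in Set.Ioi v, Real.exp (-t) * (t / (ε ^ 2 + t ^ 2))) (𝓝[>] 0)
      (𝓝 (expIntegralE1 v)) := by
  refine tendsto_integral_filter_of_dominated_convergence (fun t => Real.exp (-t) / t)
    (Eventually.of_forall fun ε => (by fun_prop : Measurable _).aestronglyMeasurable)
    (Eventually.of_forall fun ε => ?_) (integrableOn_exp_neg_div_Ioi hv) ?_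
  · refine (ae_restrict_iff' measurableSet_Ioi).2 (Eventually.of_forall fun t (ht : v < t) => ?_)
    have h0 : 0 < t := hv.trans ht
    rw [Real.norm_of_nonneg (by positivity), div_eq_mul_inv]
    exact mul_le_mul_of_nonneg_left (div_sq_add_sq_le h0 ε) (by positivity)
  · refine (ae_restrict_iff' measurableSet_Ioi).2 (Eventually.of_forall fun t (ht : v < t) => ?_)
    exact (tendsto_div_sq_add_sq (hv.trans ht).ne').const_mul _

/-- Dominated convergence: `t/(ε²+t²) ≤ 1/t`, and the factor `exp t - exp(-t)` makes this bound
integrable at `0`. -/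
theorem tendsto_integral_exp_sub_mul_regularized {v : ℝ} (hv : 0 < v) :
    Tendsto (fun ε : ℝ => ∫ t in (0 : ℝ)..v, (Real.exp t - Real.exp (-t)) * (t / (ε ^ 2 + t ^ 2)))
      (𝓝[>] 0) (𝓝 (∫ t in (0 : ℝ)..v, (Real.exp t - Real.exp (-t)) / t)) := by
  refine intervalIntegral.tendsto_integral_filter_of_dominated_convergence
    (fun t => (Real.exp t - Real.exp (-t)) / t)
    (Eventually.of_forall fun ε => (by fun_prop : Measurable _).aestronglyMeasurable)
    (Eventually.of_forall fun ε => Eventually.of_forall fun t ht => ?_)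
    (intervalIntegrable_exp_sub_exp_neg_div 0 v) (Eventually.of_forall fun t ht => ?_)
  · rw [Set.uIoc_of_le hv.le] at ht
    have h0 : 0 < t := ht.1
    have h1 : 0 ≤ Real.exp t - Real.exp (-t) := sub_nonneg.2 (Real.exp_le_exp.2 (by linarith))
    rw [Real.norm_of_nonneg (by positivity), div_eq_mul_inv]
    exact mul_le_mul_of_nonneg_left (div_sq_add_sq_le h0 ε) (by positivity)
  · rw [Set.uIoc_of_le hv.le] at ht
    exact (tendsto_div_sq_add_sq ht.1.ne').const_mul _

theorem integrableOn_exp_neg_mul_regularized {ε : ℝ} (hε : 0 < ε) (a : ℝ) :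
    IntegrableOn (fun t : ℝ => Real.exp (-t) * (t / (ε ^ 2 + t ^ 2))) (Set.Ioi a) := by
  refine (integrableOn_exp_neg_Ioi a).mul_bdd (c := ε⁻¹)
    (by fun_prop : Measurable _).aestronglyMeasurable (Eventually.of_forall fun t => ?_)
  rw [norm_div, Real.norm_eq_abs, Real.norm_of_nonneg (by positivity), inv_eq_one_div,
    div_le_div_iff₀ (by positivity) hε]
  nlinarith [sq_nonneg (ε - |t|), sq_abs t, abs_nonneg t]

/-- Splitting of the regularized Hilbert transform of `exp (-s)` on the half-line. -/
theorem integral_exp_neg_mul_regularized_split {ε : ℝ} (hε : 0 < ε) (v : ℝ) :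
    ∫ s in Set.Ioi (0 : ℝ), Real.exp (-s) *
        ((v + s) / (ε ^ 2 + (v + s) ^ 2) + (v - s) / (ε ^ 2 + (v - s) ^ 2)) =
      Real.exp v * (∫ t in Set.Ioi v, Real.exp (-t) * (t / (ε ^ 2 + t ^ 2))) +
      Real.exp (-v) * ((∫ t in (0 : ℝ)..v,
        (Real.exp t - Real.exp (-t)) * (t / (ε ^ 2 + t ^ 2))) -
        ∫ t in Set.Ioi v, Real.exp (-t) * (t / (ε ^ 2 + t ^ 2))) := by
  set p : ℝ → ℝ := fun t => t / (ε ^ 2 + t ^ 2) with hp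
  have hpc : Continuous p := by
    refine Continuous.div (by fun_prop) (by fun_prop) fun t => by positivity
  have hpn : ∀ t, p (-t) = -p t := fun t => by simp [hp, neg_div]
  set q : ℝ → ℝ := fun t => Real.exp (-t) * p t with hq
  have hqc : Continuous q := by fun_prop
  have hqi : ∀ a, IntegrableOn q (Set.Ioi a) := integrableOn_exp_neg_mul_regularized hε
  -- As `p` is odd, the shifts `t = s + v` and `t = s - v` turn both terms into integrals of the
  -- same `q`, over `(v, ∞)` and `(-v, ∞)`.
  have e1 : ∀ s, Real.exp (-s) * ((v + s) / (ε ^ 2 + (v + s) ^ 2) +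
      (v - s) / (ε ^ 2 + (v - s) ^ 2)) =
      Real.exp v * q (s + v) - Real.exp (-v) * q (s + -v) := by
    intro s
    simp only [hq]
    rw [← mul_assoc, ← mul_assoc, ← Real.exp_add, ← Real.exp_add, show s + -v = -(v - s) by ring,
      hpn, show v + -(s + v) = -s by ring, show -v + - -(v - s) = -s by ring]
    simp only [hp, add_comm s v]
    ring
  have i0 : ∀ a, IntegrableOn (fun s => q (s + a)) (Set.Ioi 0) := by
    intro a
    have := ((measurePreserving_add_right volume a).integrableOn_comp_preimage
      (measurableEmbedding_addRight a)).2 (hqi a)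
    rwa [Set.preimage_add_const_Ioi, sub_self] at this
  have s0 : ∀ a, ∫ s in Set.Ioi (0 : ℝ), q (s + a) = ∫ t in Set.Ioi a, q t := by
    intro a
    have := (measurePreserving_add_right volume a).setIntegral_preimage_emb
      (measurableEmbedding_addRight a) q (Set.Ioi a)
    rwa [Set.preimage_add_const_Ioi, sub_self] at this
  have s3 : ∫ t in Set.Ioi (-v), q t = (∫ t in (-v)..v, q t) + ∫ t in Set.Ioi v, q t :=
    (intervalIntegral.integral_interval_add_Ioi (hqi _) (hqi _)).symm
  -- Oddness of `p` folds the part around the singularity onto `(0, v)`, where the limit `ε → 0` is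
  -- harmless.
  have s4 : ∫ t in (-v)..v, q t =
      -∫ t in (0 : ℝ)..v, (Real.exp t - Real.exp (-t)) * p t := by
    rw [← intervalIntegral.integral_add_adjacent_intervals (hqc.intervalIntegrable (-v) 0)
      (hqc.intervalIntegrable 0 v)]
    have := intervalIntegral.integral_comp_neg q (a := 0) (b := v)
    rw [neg_zero] at this
    rw [← this, ← intervalIntegral.integral_add (f := fun t => q (-t))
      ((hqc.comp continuous_neg).intervalIntegrable _ _) (hqc.intervalIntegrable 0 v),
      ← intervalIntegral.integral_neg]
    congr 1
    ext t
    simp only [hq, hpn, neg_neg]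
    ring
  simp only [e1]
  rw [integral_sub ((i0 v).const_mul _) ((i0 (-v)).const_mul _), integral_const_mul, integral_const_mul,
    s0, s0, s3, s4]
  ring

/-- Let `ε → 0` on both sides of the damped identity; the terms multiplied by `exp(-v)` combine to
`Ei v` by `expIntegralEi_eq`. -/
theorem integral_sin_mul_inv_one_add_sq {v : ℝ} (hv : 0 < v) :
    ∫ y in Set.Ioi (0 : ℝ), Real.sin (v * y) * (1 + y ^ 2)⁻¹ =
      1 / 2 * (Real.exp (-v) * expIntegralEi v + Real.exp v * expIntegralE1 v) := by
  have hi : Integrable fun y : ℝ => Real.sin (v * y) * (1 + y ^ 2)⁻¹ :=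
    integrable_inv_one_add_sq.bdd_mul (c := 1)
      (by fun_prop : Continuous fun y : ℝ => Real.sin (v * y)).aestronglyMeasurable
      (Eventually.of_forall fun y => Real.abs_sin_le_one _)
  have hL : Tendsto (fun ε : ℝ => ∫ y in Set.Ioi (0 : ℝ),
      Real.exp (-(ε * y)) * (Real.sin (v * y) * (1 + y ^ 2)⁻¹)) (𝓝[>] 0)
      (𝓝 (∫ y in Set.Ioi (0 : ℝ), Real.sin (v * y) * (1 + y ^ 2)⁻¹)) := by
    refine tendsto_integral_filter_of_dominated_convergence
      (fun y => ‖Real.sin (v * y) * (1 + y ^ 2)⁻¹‖)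
      (Eventually.of_forall fun ε => (by fun_prop : Measurable _).aestronglyMeasurable)
      ?_ hi.norm.integrableOn (Eventually.of_forall fun y => ?_)
    · filter_upwards [self_mem_nhdsWithin] with ε (hε : 0 < ε)
      refine (ae_restrict_iff' measurableSet_Ioi).2 (Eventually.of_forall fun y (hy : 0 < y) => ?_)
      rw [norm_mul]
      refine mul_le_of_le_one_left (norm_nonneg _) ?_
      rw [Real.norm_of_nonneg (Real.exp_nonneg _), Real.exp_le_one_iff]
      exact neg_nonpos.2 (by positivity)
    · have hc : Continuous fun ε : ℝ =>
        Real.exp (-(ε * y)) * (Real.sin (v * y) * (1 + y ^ 2)⁻¹) := by fun_prop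
      simpa using (hc.tendsto 0).mono_left (nhdsWithin_le_nhds (s := Set.Ioi 0))
  refine tendsto_nhds_unique hL ?_
  have hE := tendsto_integral_exp_neg_mul_regularized hv
  have hR := ((hE.const_mul (Real.exp v)).add
    (((tendsto_integral_exp_sub_mul_regularized hv).sub hE).const_mul
      (Real.exp (-v)))).const_mul (1 / 2)
  rw [← expIntegralEi_eq hv, add_comm (Real.exp v * _)] at hR
  refine hR.congr' ?_
  filter_upwards [self_mem_nhdsWithin] with ε (hε : 0 < ε)
  rw [integral_damped_sin_mul_cauchy hε, integral_exp_neg_mul_regularized_split hε]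

/-! ### Fourier transform of the Cauchy density -/

theorem integrable_exp_neg_abs : Integrable fun s : ℝ => Real.exp (-|s|) := by
  rw [← integrableOn_univ, ← Set.Iic_union_Ioi (a := (0 : ℝ)), integrableOn_union]
  refine ⟨(integrableOn_exp_Iic 0).congr_fun (fun s hs => ?_) measurableSet_Iic,
    (integrableOn_exp_neg_Ioi 0).congr_fun (fun s hs => ?_) measurableSet_Ioi⟩
  · simp only [abs_of_nonpos (Set.mem_Iic.1 hs), neg_neg]
  · simp only [abs_of_pos (Set.mem_Ioi.1 hs)]

open scoped FourierTransform in
theorem fourier_exp_neg_abs (η : ℝ) :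
    𝓕 (fun s : ℝ => ((Real.exp (-|s|) : ℝ) : ℂ)) η =
      ((2 * (1 + (2 * Real.pi * η) ^ 2)⁻¹ : ℝ) : ℂ) := by
  have hi : ∀ a : ℝ, Integrable fun s : ℝ => Complex.exp (Complex.I * ((a * s : ℝ) : ℂ)) *
      ((Real.exp (-|s|) : ℝ) : ℂ) := fun a =>
    integrable_exp_neg_abs.ofReal.bdd_mul (c := 1)
      (by fun_prop : Continuous fun s : ℝ =>
        Complex.exp (Complex.I * ((a * s : ℝ) : ℂ))).aestronglyMeasurable
      (Eventually.of_forall fun y => (norm_cexp_I_mul_ofReal _).le)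
  set a := -(2 * Real.pi * η) with ha
  have h1 : 𝓕 (fun s : ℝ => ((Real.exp (-|s|) : ℝ) : ℂ)) η =
      ∫ s : ℝ, Complex.exp (Complex.I * ((a * s : ℝ) : ℂ)) * ((Real.exp (-|s|) : ℝ) : ℂ) := by
    rw [Real.fourier_eq']
    congr 1
    ext s
    rw [smul_eq_mul]
    congr 2
    simp [ha]
    ring
  rw [h1, integral_eq_integral_Ioi_add_neg (hi a)]
  calc _ = ∫ s in Set.Ioi (0 : ℝ), ((2 * (Real.exp (-(1 * s)) * Real.cos (a * s)) : ℝ) : ℂ) := by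
        refine setIntegral_congr_fun measurableSet_Ioi fun s (hs : 0 < s) => ?_
        rw [abs_neg, abs_of_pos hs, mul_comm Complex.I, mul_comm Complex.I,
          Complex.exp_mul_I, Complex.exp_mul_I]
        push_cast
        rw [mul_neg, Complex.cos_neg, Complex.sin_neg, one_mul]
        ring
    _ = _ := by
        rw [integral_complex_ofReal, integral_const_mul, integral_exp_neg_mul_cos one_pos]
        simp [ha]

-- Fourier inversion for `exp(-|s|)`, whose transform is integrable, followed by the substitution `y
-- = 2πη`.
open scoped FourierTransform in
theorem fourier_cauchy (v : ℝ) :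
    ∫ y : ℝ, Complex.exp (Complex.I * ((v * y : ℝ) : ℂ)) *
      ((Real.pi⁻¹ * (1 + y ^ 2)⁻¹ : ℝ) : ℂ) = ((Real.exp (-|v|) : ℝ) : ℂ) := by
  have hF : 𝓕 (fun s : ℝ => ((Real.exp (-|s|) : ℝ) : ℂ)) =
      fun η => ((2 * (1 + (2 * Real.pi * η) ^ 2)⁻¹ : ℝ) : ℂ) := funext fourier_exp_neg_abs
  have h := Continuous.fourierInv_fourier_eq
    (f := fun s : ℝ => ((Real.exp (-|s|) : ℝ) : ℂ)) (by fun_prop) integrable_exp_neg_abs.ofReal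
    (by
      rw [hF]
      exact ((integrable_inv_one_add_sq.comp_mul_left'
        (R := 2 * Real.pi) (by positivity)).const_mul 2).ofReal)
  have h := congrFun h v
  rw [hF, Real.fourierInv_eq'] at h
  rw [← h]
  have := Measure.integral_comp_mul_left (fun y : ℝ => Complex.exp (Complex.I * ((v * y : ℝ) : ℂ)) *
      ((Real.pi⁻¹ * (1 + y ^ 2)⁻¹ : ℝ) : ℂ)) (2 * Real.pi)
  have hpi := Real.pi_pos
  rw [eq_comm, abs_of_pos (by positivity), inv_smul_eq_iff₀ (by positivity),
    ← integral_smul] at this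
  rw [this]
  congr 1
  ext η
  rw [Complex.real_smul, smul_eq_mul]
  have hne : (Real.pi : ℂ) ≠ 0 := by exact_mod_cast hpi.ne'
  rw [show Complex.I * ((v * (2 * Real.pi * η) : ℝ) : ℂ) =
    ((2 * Real.pi * (inner ℝ η v : ℝ) : ℝ) : ℂ) * Complex.I by
      simp; ring]
  push_cast
  field_simp

theorem isEvenSpectralKernel_cauchy :
    IsEvenSpectralKernel (fun y => Real.pi⁻¹ * (1 + y ^ 2)⁻¹) (fun v => Real.exp (-|v|))
      (fun v => Real.exp (-|v|) * (Real.sign v / Real.pi *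
        (expIntegralEi |v| + Real.exp (2 * |v|) * expIntegralE1 |v|))) where
  nonneg y := by positivity
  abs y := by simp
  continuous := continuous_const.mul
    (Continuous.inv₀ (by fun_prop) fun y => by positivity)
  integrable := integrable_inv_one_add_sq.const_mul _
  fourier := fourier_cauchy
  signFourier v := by
    have key : ∀ {v : ℝ}, 0 < v →
        2 * ∫ y in Set.Ioi (0 : ℝ), Real.sin (v * y) * (Real.pi⁻¹ * (1 + y ^ 2)⁻¹) =
        Real.exp (-v) * (1 / Real.pi *
          (expIntegralEi v + Real.exp (2 * v) * expIntegralE1 v)) := by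
      intro v hv
      simp only [mul_left_comm _ Real.pi⁻¹]
      rw [integral_const_mul, integral_sin_mul_inv_one_add_sq hv,
        show Real.exp v = Real.exp (-v) * Real.exp (2 * v) by rw [← Real.exp_add]; ring_nf]
      ring
    rw [integral_sign_fourier (integrable_inv_one_add_sq.const_mul _) (fun y => by simp)]
    congr 2
    -- Both sides are odd in `v`; at `v = 0` the sign is zero, so the junk values of `Ei` and `E₁`
    -- there do not matter.
    rcases lt_trichotomy v 0 with hv | rfl | hv
    · rw [abs_of_neg hv, Real.sign_of_neg hv]
      have h := key (neg_pos.2 hv)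
      simp only [neg_mul, Real.sin_neg, integral_neg] at h ⊢
      linear_combination -h
    · simp
    · rw [abs_of_pos hv, Real.sign_of_pos hv, key hv]

/-! ### Identification of the two Gneiting models -/

/-- The squared-exponential Gneiting covariance as a Gaussian integral over the space variable. -/
theorem sqExpGneitingCovariance_eq_integral {d : ℕ} {σ aₛ : ℝ} (haₛ : 0 < aₛ) {γ : ℝ → ℝ}
    (hγ : ∀ u, 0 ≤ γ u) (h : EuclideanSpace ℝ (Fin d)) (u : ℝ) :
    ((sqExpGneitingCovariance σ aₛ γ h u : ℝ) : ℂ) = σ * ∫ x : EuclideanSpace ℝ (Fin d),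
      Complex.exp (Complex.I * (inner ℝ h x : ℝ)) *
        ((1 / (2 * aₛ * Real.sqrt Real.pi) ^ d * Real.exp (-(1 / (4 * aₛ ^ 2) * ‖x‖ ^ 2)) *
          Real.exp (-(1 / (4 * aₛ ^ 2) * ‖x‖ ^ 2 * γ u)) : ℝ) : ℂ) := by
  have hg : 0 < γ u + 1 := by linarith [hγ u]
  have hpi := Real.pi_pos
  set b : ℝ := (γ u + 1) / (4 * aₛ ^ 2) with hb
  have hb0 : 0 < b := by positivity
  have hG := GaussianFourier.integral_cexp_neg_mul_sq_norm_add (V := EuclideanSpace ℝ (Fin d))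
    (b := (b : ℂ)) (by simpa using hb0) Complex.I h
  rw [finrank_euclideanSpace_fin] at hG
  -- Since `π/b = (2aₛ√π)²/(γ u + 1)`, the Gaussian constant cancels the normalisation and leaves
  -- `(γ u + 1)^(-d/2)`.
  have hp : ((Real.pi : ℂ) / b) ^ ((d : ℂ) / 2) =
      (((2 * aₛ * Real.sqrt Real.pi) ^ d / (γ u + 1) ^ ((d : ℝ) / 2) : ℝ) : ℂ) := by
    rw [← Complex.ofReal_div, show (d : ℂ) / 2 = (((d : ℝ) / 2 : ℝ) : ℂ) by push_cast; rfl,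
      ← Complex.ofReal_cpow (by positivity), show Real.pi / b =
        (2 * aₛ * Real.sqrt Real.pi) ^ 2 / (γ u + 1) by
          rw [mul_pow, Real.sq_sqrt hpi.le, hb]; field_simp; ring,
      Real.div_rpow (by positivity) hg.le, ← Real.rpow_natCast_mul (by positivity)]
    rw [show ((2 : ℕ) : ℝ) * ((d : ℝ) / 2) = d by push_cast; ring, Real.rpow_natCast]
  rw [hp] at hG
  have hI : ∫ x : EuclideanSpace ℝ (Fin d), Complex.exp (Complex.I * (inner ℝ h x : ℝ)) *
        ((1 / (2 * aₛ * Real.sqrt Real.pi) ^ d * Real.exp (-(1 / (4 * aₛ ^ 2) * ‖x‖ ^ 2)) *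
          Real.exp (-(1 / (4 * aₛ ^ 2) * ‖x‖ ^ 2 * γ u)) : ℝ) : ℂ) =
      ((1 / (2 * aₛ * Real.sqrt Real.pi) ^ d : ℝ) : ℂ) * ∫ x : EuclideanSpace ℝ (Fin d),
        Complex.exp (-(b : ℂ) * ‖x‖ ^ 2 + Complex.I * (inner ℝ h x : ℝ)) := by
    rw [← integral_const_mul]
    congr 1
    ext x
    rw [mul_assoc (1 / _ : ℝ), ← Real.exp_add, Complex.exp_add,
      show -(1 / (4 * aₛ ^ 2) * ‖x‖ ^ 2) + -(1 / (4 * aₛ ^ 2) * ‖x‖ ^ 2 * γ u) = -b * ‖x‖ ^ 2 by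
        rw [hb]; ring]
    push_cast
    ring
  rw [hI, hG, show Complex.I ^ 2 * (‖h‖ : ℂ) ^ 2 / (4 * b) =
    ((-(aₛ ^ 2 * (‖h‖ ^ 2 / (γ u + 1) ^ (1 : ℝ))) : ℝ) : ℂ) by
      have : (-(aₛ ^ 2 * (‖h‖ ^ 2 / (γ u + 1) ^ (1 : ℝ))) : ℝ) = -1 * ‖h‖ ^ 2 / (4 * b) := by
        rw [hb, Real.rpow_one]; field_simp
      rw [this, Complex.I_sq]
      push_cast
      rfl, ← Complex.ofReal_exp, ← Complex.ofReal_mul, ← Complex.ofReal_mul,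
      ← Complex.ofReal_mul]
  congr 1
  unfold sqExpGneitingCovariance gneitingCovariance
  field_simp

theorem halfSpectralQuadratic_eq {d : ℕ} {aₛ : ℝ} (ξ aₜ : ℝ)
    (xt x : EuclideanSpace ℝ (Fin d)) (u : ℝ) :
    halfSpectralQuadratic ξ aₛ aₜ xt x u =
      ((1 / (2 * aₛ * Real.sqrt Real.pi) ^ d *
        Real.exp (-(1 / (4 * aₛ ^ 2) * ‖x‖ ^ 2)) : ℝ) : ℂ) *
      ((Real.exp (-(‖x‖ / (2 * aₛ) * aₜ * u) ^ 2) : ℂ) + Complex.I *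
        ((ξ * Real.sign (inner ℝ x xt) * (Real.exp (-(‖x‖ / (2 * aₛ) * aₜ * u) ^ 2) *
          realErfi (‖x‖ / (2 * aₛ) * aₜ * u)) : ℝ) : ℂ)) := by
  unfold halfSpectralQuadratic
  rw [show -(‖x‖ ^ 2 / (4 * aₛ ^ 2) * (aₜ ^ 2 * u ^ 2 + 1)) =
    -(1 / (4 * aₛ ^ 2) * ‖x‖ ^ 2) + -(‖x‖ / (2 * aₛ) * aₜ * u) ^ 2 by ring, Real.exp_add]
  push_cast
  ring

theorem halfSpectralLinear_eq {d : ℕ} {aₛ aₜ : ℝ} (haₛ : 0 < aₛ) (haₜ : 0 < aₜ) (ξ : ℝ)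
    (xt x : EuclideanSpace ℝ (Fin d)) (u : ℝ) :
    halfSpectralLinear ξ aₛ aₜ xt x u =
      ((1 / (2 * aₛ * Real.sqrt Real.pi) ^ d *
        Real.exp (-(1 / (4 * aₛ ^ 2) * ‖x‖ ^ 2)) : ℝ) : ℂ) *
      ((Real.exp (-|‖x‖ ^ 2 / (4 * aₛ ^ 2) * aₜ * u|) : ℂ) + Complex.I *
        ((ξ * Real.sign (inner ℝ x xt) * (Real.exp (-|‖x‖ ^ 2 / (4 * aₛ ^ 2) * aₜ * u|) *
          (Real.sign (‖x‖ ^ 2 / (4 * aₛ ^ 2) * aₜ * u) / Real.pi *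
            (expIntegralEi |‖x‖ ^ 2 / (4 * aₛ ^ 2) * aₜ * u| +
              Real.exp (2 * |‖x‖ ^ 2 / (4 * aₛ ^ 2) * aₜ * u|) *
                expIntegralE1 |‖x‖ ^ 2 / (4 * aₛ ^ 2) * aₜ * u|))) : ℝ) : ℂ)) := by
  have hw : |‖x‖ ^ 2 / (4 * aₛ ^ 2) * aₜ * u| = ‖x‖ ^ 2 / (4 * aₛ ^ 2) * aₜ * |u| := by
    rw [abs_mul, abs_of_nonneg (by positivity)]
  -- The kernel yields the sign of `κ(‖x‖) u` rather than of `u`; these can differ only at `x = 0`,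
  -- where `sign⟨x, x̃⟩` vanishes.
  have hs : Real.sign (inner ℝ x xt) * Real.sign (‖x‖ ^ 2 / (4 * aₛ ^ 2) * aₜ * u) =
      Real.sign (inner ℝ x xt) * Real.sign u := by
    rcases eq_or_ne x 0 with rfl | hx
    · simp
    · rw [realSign_mul_of_pos]
      have := norm_pos_iff.2 hx
      positivity
  rw [hw]
  unfold halfSpectralLinear asymFactorZ
  generalize hW : ‖x‖ ^ 2 / (4 * aₛ ^ 2) * aₜ * |u| = w at *
  rw [show -(‖x‖ ^ 2 / (4 * aₛ ^ 2) * (aₜ * |u| + 1)) =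
    -(1 / (4 * aₛ ^ 2) * ‖x‖ ^ 2) + -w by rw [← hW]; ring, Real.exp_add,
    show ξ * Real.sign (inner ℝ x xt) * (Real.sign u / Real.pi *
      (expIntegralEi w + Real.exp (2 * w) * expIntegralE1 w)) =
      ξ * (Real.sign (inner ℝ x xt) * Real.sign u) / Real.pi *
      (expIntegralEi w + Real.exp (2 * w) * expIntegralE1 w) by ring, ← hs]
  push_cast
  ring

theorem propositionA2 (d : ℕ) (σ ξ aₛ aₜ : ℝ) (hσ : 0 < σ) (hξ : ξ ∈ Set.Ioo (-1 : ℝ) 1)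
    (haₛ : 0 < aₛ) (haₜ : 0 < aₜ) (xt : EuclideanSpace ℝ (Fin d)) (hxt : ‖xt‖ = 1) :
    -- the case `γ u = aₜ² u²`
    ((∃ fstar : ℝ → ℝ → ℝ, IsSpaceTimeSpectralDensity
        (sqExpGneitingCovariance (d := d) σ aₛ (fun u => aₜ ^ 2 * u ^ 2))
        (fun x η => σ * fstar ‖x‖ |η|)) ∧
      ∀ fstar : ℝ → ℝ → ℝ, IsSpaceTimeSpectralDensity
          (sqExpGneitingCovariance (d := d) σ aₛ (fun u => aₜ ^ 2 * u ^ 2))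
          (fun x η => σ * fstar ‖x‖ |η|) →
        ∀ (h : EuclideanSpace ℝ (Fin d)) (u : ℝ),
          MeasureTheory.Integrable
            (fun x : EuclideanSpace ℝ (Fin d) => halfSpectralQuadratic ξ aₛ aₜ xt x u) ∧
          asymCovariance σ ξ xt fstar h u =
            σ * ∫ x : EuclideanSpace ℝ (Fin d),
              Complex.exp (Complex.I * (inner ℝ h x : ℝ)) *
                halfSpectralQuadratic ξ aₛ aₜ xt x u) ∧
    -- the case `γ u = aₜ |u|`
    ((∃ fstar : ℝ → ℝ → ℝ, IsSpaceTimeSpectralDensity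
        (sqExpGneitingCovariance (d := d) σ aₛ (fun u => aₜ * |u|))
        (fun x η => σ * fstar ‖x‖ |η|)) ∧
      ∀ fstar : ℝ → ℝ → ℝ, IsSpaceTimeSpectralDensity
          (sqExpGneitingCovariance (d := d) σ aₛ (fun u => aₜ * |u|))
          (fun x η => σ * fstar ‖x‖ |η|) →
        ∀ (h : EuclideanSpace ℝ (Fin d)) (u : ℝ),
          MeasureTheory.Integrable
            (fun x : EuclideanSpace ℝ (Fin d) => halfSpectralLinear ξ aₛ aₜ xt x u) ∧
          asymCovariance σ ξ xt fstar h u =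
            σ * ∫ x : EuclideanSpace ℝ (Fin d),
              Complex.exp (Complex.I * (inner ℝ h x : ℝ)) *
                halfSpectralLinear ξ aₛ aₜ xt x u) := by
  have hpi := Real.pi_pos
  constructor
  -- `κ` is chosen so that `(κ(r) u)² = β r² γ(u)`.
  · refine halfSpectral_representation (A := 1 / (2 * aₛ * Real.sqrt Real.pi) ^ d)
      (β := 1 / (4 * aₛ ^ 2)) (κ := fun r => r / (2 * aₛ) * aₜ) isEvenSpectralKernel_gaussian
      (by positivity) (by positivity) hσ.le (by fun_prop) (fun r hr => by positivity) hxt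
      (fun h u => ?_) (halfSpectralQuadratic_eq ξ aₜ xt)
    rw [sqExpGneitingCovariance_eq_integral haₛ (fun u => by positivity)]
    congr 3
    ext x
    congr 5
    ring
  -- Here the requirement is `|κ(r) u| = β r² γ(u)`, so `κ` is quadratic in `r`.
  · refine halfSpectral_representation (A := 1 / (2 * aₛ * Real.sqrt Real.pi) ^ d)
      (β := 1 / (4 * aₛ ^ 2)) (κ := fun r => r ^ 2 / (4 * aₛ ^ 2) * aₜ)
      isEvenSpectralKernel_cauchy
      (by positivity) (by positivity) hσ.le (by fun_prop) (fun r hr => by positivity) hxt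
      (fun h u => ?_) (halfSpectralLinear_eq haₛ haₜ ξ xt)
    rw [sqExpGneitingCovariance_eq_integral haₛ (fun u => by positivity)]
    congr 3
    ext x
    rw [abs_mul, abs_of_nonneg (by positivity : 0 ≤ ‖x‖ ^ 2 / (4 * aₛ ^ 2) * aₜ)]
    congr 5
    ring
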